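/- Let $0<\beta<1$. For a function $f$ on $D=[0,1]$ or $D=\mathbb R$ put $\|f\|_{\mathscr C^\beta(D)}=\sup_{x\in D}|f(x)|+\sup_{x,y\in D,\,x\neq y}|f(x)-f(y)|/|x-y|^\beta$, and let $\mathscr C^\beta(r)=\{f:[0,1]\to\mathbb R:\ \|f\|_{\mathscr C^\beta([0,1])}\le r\}$. For $n\ge 1$ let $P_f$ be the law of a Poisson point process on $[0,1]\times\mathbb R$ with intensity $\lambda_f(x,y)=n\mathbf 1(f(x)\le y)$. For $x_0\in[0,1]$, an estimator $\widehat f(x_0)$ of $f(x_0)$ is a real-valued measurable function of the observed point process. Write $\operatorname{Bias}_f(\widehat f(x_0))=E_f[\widehat f(x_0)]-f(x_0)$, $\operatorname{MSE}_f(\widehat f(x_0))=E_f[(\widehat f(x_0)-f(x_0))^2]$, and $\operatorname{Var}_f$ for the variance, under $P_f$. **Theorem.** Let $0<\beta<1$, $C>0$ and $$R>\kappa:=2\inf\{\|K\|_{\mathscr C^\beta(\mathbb R)}:\ K\in L^2(\mathbb R),\ K(0)=1,\ K\ge 0\}.$$ There exist positive constants $c=c(\beta,C,R)$ and $c'=c'(\beta,C,R)$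 such that for every $n\ge 1$, every $x_0\in[0,1]$ and every estimator $\widehat f(x_0)$ with $$\sup_{f\in\mathscr C^\beta(R)}\operatorname{MSE}_f\big(\widehat f(x_0)\big)<\Big(\frac Cn\Big)^{\frac{2\beta}{\beta+1}}$$ we have $$\sup_{f\in\mathscr C^\beta(R)}\operatorname{Bias}_f\big(\widehat f(x_0)\big)^2\ \ge\ c\,n^{-\frac{2\beta}{\beta+1}},$$ and, if moreover $\sup_{f\in\mathscr C^\beta(R)}|\operatorname{Bias}_f(\widehat f(x_0))|\le 1$ (which is automatic when $n\ge C$), $$\operatorname{Var}_f\big(\widehat f(x_0)\big)\ \ge\ c'\,n^{-\frac{2\beta}{\beta+1}}\qquad\text{for all } f\in\mathscr C^\beta\big((R-\kappa)/2\big).$$ -/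

import Mathlib

open MeasureTheory ProbabilityTheory
open scoped ENNReal unitInterval

/-- The `β`-Hölder norm `sup |f| + sup_{x ≠ y} |f x - f y| / |x - y| ^ β` for a smoothness index
`0 < β ≤ 1` (so that no derivatives enter), with value `∞` when one of the suprema is infinite.
It is used for functions on the whole line and on the unit interval. -/
noncomputable def holderNorm {D : Type*} [MetricSpace D] (β : ℝ) (f : D → ℝ) : ℝ≥0∞ :=
  (⨆ x : D, ENNReal.ofReal |f x|) +
    ⨆ (x : D) (y : D) (_ : x ≠ y), ENNReal.ofReal (|f x - f y| / dist x y ^ β)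

/-- The closed ball of radius `r` of `β`-Hölder functions `[0,1] → ℝ`. -/
def holderBall (β : ℝ) (r : ℝ≥0∞) : Set (I → ℝ) :=
  {f | holderNorm β f ≤ r}

/-- `κ = 2 inf ‖K‖`, where the infimum of the Hölder norm over `ℝ` is taken over all
square-integrable `K : ℝ → ℝ` with `K 0 = 1` and `K ≥ 0`. -/
noncomputable def kappa (β : ℝ) : ℝ≥0∞ :=
  2 * ⨅ (K : ℝ → ℝ) (_ : MemLp K 2 volume ∧ K 0 = 1 ∧ ∀ x, 0 ≤ K x), holderNorm β K

/-- `P`, a law of a random measure on `E`, is the law of a Poisson point process with intensity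
measure `Λ`: the mass of a measurable set `A` with `Λ A < ∞` has the Poisson distribution with
parameter `Λ A`, and the masses of finitely many pairwise disjoint measurable sets are
independent. `Measure E` carries the σ-algebra generated by the evaluations `N ↦ N A`. -/
structure IsPoissonPointProcess {E : Type*} [MeasurableSpace E]
    (P : Measure (Measure E)) (Λ : Measure E) : Prop where
  isProbabilityMeasure : IsProbabilityMeasure P
  map_eval : ∀ A : Set E, MeasurableSet A → Λ A ≠ ∞ →
    P.map (fun N : Measure E => N A) =
      (poissonMeasure (Λ A).toNNReal).map (fun k : ℕ => (k : ℝ≥0∞))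
  indep : ∀ (m : ℕ) (A : Fin m → Set E), (∀ i, MeasurableSet (A i)) →
    Pairwise (fun i j => Disjoint (A i) (A j)) →
    iIndepFun (fun (i : Fin m) (N : Measure E) => N (A i)) P

/-- The measure on `[0,1] × ℝ` with Lebesgue density `λ_f(x, y) = n 1(f(x) ≤ y)`. -/
noncomputable def boundaryIntensity (n : ℝ) (f : I → ℝ) : Measure (I × ℝ) :=
  (volume : Measure (I × ℝ)).withDensity
    (Set.indicator {p : I × ℝ | f p.1 ≤ p.2} (fun _ => ENNReal.ofReal n))

/-- Bias of the statistic `T` for the value `a` when the data have law `P`. -/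
noncomputable def bias {S : Type*} [MeasurableSpace S] (P : Measure S) (T : S → ℝ) (a : ℝ) : ℝ :=
  (∫ N, T N ∂P) - a

/-- Mean squared error of the statistic `T` for the value `a` when the data have law `P`. -/
noncomputable def mse {S : Type*} [MeasurableSpace S] (P : Measure S) (T : S → ℝ) (a : ℝ) :
    ℝ≥0∞ :=
  ∫⁻ N, ENNReal.ofReal ((T N - a) ^ 2) ∂P

/-! Raising the boundary from f to g ≥ f only deletes the points between the two graphs. So `P g` is
`P f` conditioned on the event Z that this region A is empty, and Z has probability q = exp(-Λ(A))
(`IsPoissonPointProcess.cond_eq`). The density of `P g` relative to `P f` is 1_Z / q, its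
χ²-divergence is exp(Λ(A)) - 1, and Cauchy–Schwarz bounds the squared change of the mean of T by
(exp(Λ(A)) - 1) Var_f(T) (`sq_integral_cond_sub_le`).

Take g = f + peak, where the peak has height a and fixed steepness L at x₀. If a = t
(C/n)^(β/(β+1)), then Λ(A) is at most a constant times t^(1+1/β), uniformly in n. The estimand moves
by a, so the mean has to follow or the bias changes. Bias bound: the MSE assumption bounds the
variance, and for small t the mean moves by at most a/2. The biases at 0 and at the peak then differ
by at least a/2, so one of them is at least a/4 in absolute value. Variance bound: for t = 3 the
bounded biases force the mean to move by at least a constant times n^(-β/(β+1)), which is impossible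
if Var_f(T) is too small. -/

/-! ### Uniqueness of laws of random measures. -/

/-- The σ-algebra on measures is generated by the evaluations at the sets of finite mass for a
fixed σ-finite measure. -/
theorem comap_eval_finite_eq {E : Type*} [MeasurableSpace E] (Λ : Measure E) [SigmaFinite Λ] :
    MeasurableSpace.comap
      (fun (N : Measure E) (A : {A : Set E // MeasurableSet A ∧ Λ A ≠ ∞}) => N A)
      MeasurableSpace.pi = Measure.instMeasurableSpace := by
  refine le_antisymm ?_ ?_
  · exact (measurable_pi_lambda _ fun A => Measure.measurable_coe A.2.1).comap_le
  · refine iSup₂_le fun s hs => ?_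
    rw [← measurable_iff_comap_le]
    have hA : ∀ k, MeasurableSet (s ∩ disjointed (spanningSets Λ) k) ∧
        Λ (s ∩ disjointed (spanningSets Λ) k) ≠ ∞ := fun k =>
      ⟨hs.inter (MeasurableSet.disjointed (measurableSet_spanningSets Λ) k),
        ((measure_mono (Set.inter_subset_right.trans (disjointed_subset _ _))).trans_lt
          (measure_spanningSets_lt_top Λ k)).ne⟩
    have hG : Measurable fun v : {A : Set E // MeasurableSet A ∧ Λ A ≠ ∞} → ℝ≥0∞ =>
        ∑' k, v ⟨_, hA k⟩ := Measurable.tsum fun k => measurable_pi_apply _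
    have hdecomp : (fun N : Measure E => N s) =
        (fun v : {A : Set E // MeasurableSet A ∧ Λ A ≠ ∞} → ℝ≥0∞ => ∑' k, v ⟨_, hA k⟩) ∘
          fun N A => N A := by
      funext N
      simp only [Function.comp]
      rw [← measure_iUnion]
      · rw [← Set.inter_iUnion, iUnion_disjointed, iUnion_spanningSets, Set.inter_univ]
      · exact fun i j hij => (disjoint_disjointed _ hij).mono Set.inter_subset_right
          Set.inter_subset_right
      · exact fun k => (hA k).1
    rw [hdecomp]
    exact hG.comp (comap_measurable _)

/-- The cell of the partition generated by a family of sets. -/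
def familyAtom {E J : Type*} (A : J → Set E) (s : Finset J) : Set E :=
  {x | ∀ j, x ∈ A j ↔ j ∈ s}

theorem measurableSet_familyAtom {E J : Type*} [MeasurableSpace E] [Fintype J] {A : J → Set E}
    (hA : ∀ j, MeasurableSet (A j)) (s : Finset J) : MeasurableSet (familyAtom A s) := by
  have : familyAtom A s = ⋂ j, {x | x ∈ A j ↔ j ∈ s} := by ext; simp [familyAtom]
  rw [this]
  refine MeasurableSet.iInter fun j => ?_
  by_cases hj : j ∈ s
  · simpa [hj] using hA j
  · have : {x | x ∈ A j ↔ j ∈ s} = (A j)ᶜ := by ext; simp [hj]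
    exact this ▸ (hA j).compl

theorem disjoint_familyAtom {E J : Type*} {A : J → Set E} {s t : Finset J} (h : s ≠ t) :
    Disjoint (familyAtom A s) (familyAtom A t) := by
  rw [Set.disjoint_left]
  intro x hs ht
  exact h (Finset.ext fun j => (hs j).symm.trans (ht j))

theorem familyAtom_subset {E J : Type*} {A : J → Set E} {s : Finset J} {j : J} (h : j ∈ s) :
    familyAtom A s ⊆ A j := fun _ hx => (hx j).2 h

theorem measure_eq_sum_familyAtom {E J : Type*} [MeasurableSpace E] [Fintype J] [DecidableEq J]
    {A : J → Set E} (hA : ∀ j, MeasurableSet (A j)) (N : Measure E) (j : J) :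
    N (A j) = ∑ s : {s : Finset J // s.Nonempty},
      if j ∈ s.1 then N (familyAtom A s.1) else 0 := by
  classical
  rw [← Finset.sum_filter, ← measure_biUnion_finset]
  · congr 1
    ext x
    simp only [Finset.mem_filter, Finset.mem_univ, true_and, Set.mem_iUnion, exists_prop,
      Subtype.exists]
    constructor
    · intro hx
      exact ⟨Finset.univ.filter (fun i => x ∈ A i), ⟨j, by simpa using hx⟩, by simpa using hx,
        fun i => by simp⟩
    · rintro ⟨s, _, hj, hx⟩
      exact familyAtom_subset hj hx
  · intro s _ t _ hst
    exact disjoint_familyAtom fun h => hst (Subtype.ext h)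
  · exact fun s _ => measurableSet_familyAtom hA _

/-- Laws of random measures agree if the joint laws of the masses of disjoint sets agree. -/
theorem randomMeasure_law_ext {E : Type*} [MeasurableSpace E] (Λ : Measure E) [SigmaFinite Λ]
    {P Q : Measure (Measure E)} [IsProbabilityMeasure P] [IsProbabilityMeasure Q]
    (h : ∀ (m : ℕ) (B : Fin m → Set E), (∀ i, MeasurableSet (B i)) → (∀ i, Λ (B i) ≠ ∞) →
      Pairwise (fun i j => Disjoint (B i) (B j)) →
      P.map (fun N i => N (B i)) = Q.map (fun N i => N (B i))) : P = Q := by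
  classical
  have hΦ := comap_eval_finite_eq Λ
  set Φ := fun (N : Measure E) (A : {A : Set E // MeasurableSet A ∧ Λ A ≠ ∞}) => N A with hΦdef
  have hΦm : Measurable Φ := measurable_pi_lambda _ fun A => Measure.measurable_coe A.2.1
  have key : P.map Φ = Q.map Φ := by
    refine IsProjectiveLimit.unique (P := fun J => (P.map Φ).map J.restrict) (fun J => rfl)
      fun J => ?_
    have hr : Measurable (J.restrict (π := fun _ => ℝ≥0∞)) := by fun_prop
    change (Q.map Φ).map J.restrict = (P.map Φ).map J.restrict
    rw [Measure.map_map hr hΦm, Measure.map_map hr hΦm]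
    let A : J → Set E := fun j => j.1.1
    have hA : ∀ j, MeasurableSet (A j) := fun j => j.1.2.1
    -- The empty index set is left out: its atom lies outside every `A j` and may have infinite
    -- `Λ`-mass.
    let e := Fintype.equivFin {s : Finset J // s.Nonempty}
    let B : Fin (Fintype.card {s : Finset J // s.Nonempty}) → Set E :=
      fun i => familyAtom A (e.symm i).1
    have hB : ∀ i, MeasurableSet (B i) := fun i => measurableSet_familyAtom hA _
    let Ψ : (Fin (Fintype.card {s : Finset J // s.Nonempty}) → ℝ≥0∞) → (J → ℝ≥0∞) :=
      fun v j => ∑ s : {s : Finset J // s.Nonempty}, if j ∈ s.1 then v (e s) else 0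
    have hΨ : Measurable Ψ := by
      refine measurable_pi_lambda _ fun j => Finset.measurable_sum _ fun s _ => ?_
      by_cases hj : j ∈ s.1
      · simpa [hj] using measurable_pi_apply _
      · simp [hj]
    have hcomp : J.restrict ∘ Φ = Ψ ∘ fun N i => N (B i) := by
      funext N j
      simp only [Function.comp, Ψ, B, Equiv.symm_apply_apply]
      exact measure_eq_sum_familyAtom hA N j
    have hBm : Measurable fun (N : Measure E) i => N (B i) :=
      measurable_pi_lambda _ fun i => Measure.measurable_coe (hB i)
    rw [hcomp, ← Measure.map_map hΨ hBm, ← Measure.map_map hΨ hBm, h _ B hB]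
    · intro i
      obtain ⟨j, hj⟩ := (e.symm i).2
      exact ((measure_mono (familyAtom_subset hj)).trans_lt j.1.2.2.lt_top).ne
    · intro i k hik
      exact disjoint_familyAtom fun h => hik (e.symm.injective (Subtype.ext h))
  ext S hS
  rw [← hΦ] at hS
  obtain ⟨D, hD, rfl⟩ := hS
  rw [← Measure.map_apply hΦm hD, ← Measure.map_apply hΦm hD, key]

/-! ### Void probabilities and conditioning of Poisson processes. -/

theorem IsPoissonPointProcess.measure_eq_zero {E : Type*} [MeasurableSpace E]
    {P : Measure (Measure E)} {Λ : Measure E} (hP : IsPoissonPointProcess P Λ) {A : Set E}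
    (hA : MeasurableSet A) (hΛA : Λ A ≠ ∞) :
    P {N | N A = 0} = ENNReal.ofReal (Real.exp (-(Λ A).toReal)) := by
  have h := congrArg (fun μ => μ {0}) (hP.map_eval A hA hΛA)
  rw [Measure.map_apply (Measure.measurable_coe hA) (measurableSet_singleton _),
    Measure.map_apply (by fun_prop) (measurableSet_singleton _)] at h
  have h0 : (fun k : ℕ => (k : ℝ≥0∞)) ⁻¹' {0} = {0} := by ext; simp
  rw [h0, poissonMeasure_singleton] at h
  simpa [Set.preimage, ENNReal.coe_toNNReal_eq_toReal] using h

/-- Conditionally on having no points in `A`, a Poisson point process is a Poisson point process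
with the intensity restricted to the complement of `A`. -/
theorem IsPoissonPointProcess.cond_eq {E : Type*} [MeasurableSpace E]
    {P Q : Measure (Measure E)} {Λ : Measure E} [SigmaFinite Λ] {A : Set E}
    (hA : MeasurableSet A) (hΛA : Λ A ≠ ∞)
    (hP : IsPoissonPointProcess P Λ) (hQ : IsPoissonPointProcess Q (Λ.restrict Aᶜ)) :
    P[|{N | N A = 0}] = Q := by
  have := hP.isProbabilityMeasure
  have := hQ.isProbabilityMeasure
  have hZ0 : P {N | N A = 0} ≠ 0 := by
    rw [hP.measure_eq_zero hA hΛA]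
    simp [Real.exp_pos]
  have hZm : MeasurableSet {N : Measure E | N A = 0} :=
    Measure.measurable_coe hA (measurableSet_singleton _)
  have := cond_isProbabilityMeasure hZ0
  refine randomMeasure_law_ext Λ fun m B hB hΛB hdisj => ?_
  have hBm : Measurable fun (N : Measure E) i => N (B i) :=
    measurable_pi_lambda _ fun i => Measure.measurable_coe (hB i)
  have hQmap : Q.map (fun N i => N (B i)) = Measure.pi fun i => Q.map fun N => N (B i) :=
    (iIndepFun_iff_map_fun_eq_pi_map fun i => (Measure.measurable_coe (hB i)).aemeasurable).1
      (hQ.indep m B hB hdisj)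
  rw [hQmap]
  have hprob : ∀ i, IsProbabilityMeasure (Q.map fun N : Measure E => N (B i)) := fun i =>
    Measure.isProbabilityMeasure_map (Measure.measurable_coe (hB i)).aemeasurable
  refine (Measure.pi_eq fun S hS => ?_).symm
  have hmarg : ∀ i, (Q.map fun N => N (B i)) (S i) = P {N | N (B i \ A) ∈ S i} := by
    intro i
    have hΛ : (Λ.restrict Aᶜ) (B i) = Λ (B i \ A) := Measure.restrict_apply (hB i)
    have hfin : Λ (B i \ A) ≠ ∞ := ((measure_mono Set.sdiff_subset).trans_lt (hΛB i).lt_top).ne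
    rw [hQ.map_eval _ (hB i) (hΛ ▸ hfin), hΛ, ← hP.map_eval _ ((hB i).diff hA) hfin,
      Measure.map_apply (Measure.measurable_coe ((hB i).diff hA)) (hS i)]
    rfl
  rw [Measure.map_apply hBm (MeasurableSet.univ_pi hS), cond_apply hZm]
  -- With `A` prepended to the disjoint pieces `B i \ A`, independence splits off the void event as
  -- one factor. On that event `N (B i)` equals `N (B i \ A)`.
  let A' : Fin (m + 1) → Set E := Fin.cons A fun i => B i \ A
  let S' : Fin (m + 1) → Set ℝ≥0∞ := Fin.cons {0} S
  have hA' : ∀ i, MeasurableSet (A' i) := by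
    intro i
    refine Fin.cases hA (fun i => (hB i).diff hA) i
  have hS' : ∀ i, MeasurableSet (S' i) := by
    intro i
    refine Fin.cases (measurableSet_singleton _) hS i
  have hd' : Pairwise fun i j => Disjoint (A' i) (A' j) := by
    intro i j
    refine Fin.cases ?_ (fun i => ?_) i <;> refine Fin.cases ?_ (fun j => ?_) j
    · simp
    · intro _
      exact Set.disjoint_sdiff_right
    · intro _
      exact Set.disjoint_sdiff_left
    · intro hij
      exact (hdisj fun h => hij (congrArg _ h)).mono Set.sdiff_subset Set.sdiff_subset
  have hind := (hP.indep (m + 1) A' hA' hd').measure_inter_preimage_eq_mul Finset.univ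
    (sets := S') (fun i _ => hS' i)
  have hset : {N : Measure E | N A = 0} ∩ (fun N i => N (B i)) ⁻¹' Set.univ.pi S =
      ⋂ i ∈ (Finset.univ : Finset (Fin (m + 1))), (fun N => N (A' i)) ⁻¹' S' i := by
    ext N
    simp only [Set.mem_inter_iff, Set.mem_ofPred_eq, Set.mem_preimage, Set.mem_univ_pi,
      Finset.mem_univ, Set.iInter_true, Set.mem_iInter, Fin.forall_fin_succ, A', S',
      Fin.cons_zero, Fin.cons_succ, Set.mem_singleton_iff]
    refine and_congr_right fun h0 => forall_congr' fun i => ?_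
    rw [measure_sdiff_null h0]
  rw [hset, hind, Fin.prod_univ_succ, ← mul_assoc]
  have h0 : (fun N : Measure E => N (A' 0)) ⁻¹' S' 0 = {N | N A = 0} := rfl
  rw [h0, ENNReal.inv_mul_cancel hZ0 (measure_ne_top _ _), one_mul]
  exact Finset.prod_congr rfl fun i _ => (hmarg i).symm

/-! ### Second-moment inequalities. -/

/-- The change of mean under conditioning is controlled by the variance and the
`χ²`-divergence. -/
theorem sq_integral_cond_sub_le {Ω : Type*} [MeasurableSpace Ω] {P : Measure Ω}
    [IsProbabilityMeasure P] {Z : Set Ω} (hZ : MeasurableSet Z) (hZ0 : P Z ≠ 0) {T : Ω → ℝ}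
    (hT : MemLp T 2 P) :
    ((∫ ω, T ω ∂P[|Z]) - ∫ ω, T ω ∂P) ^ 2 ≤ ((P.real Z)⁻¹ - 1) * Var[T; P] := by
  have hTi : Integrable T P := hT.integrable (by norm_num)
  set q := P.real Z with hq
  have hq0 : 0 < q := by
    rw [hq, measureReal_def]
    exact ENNReal.toReal_pos hZ0 (measure_ne_top _ _)
  set μ := ∫ ω, T ω ∂P with hμ
  have hU : MemLp (fun ω => T ω - μ) 2 P := hT.sub (memLp_const μ)
  have hUi : Integrable (fun ω => T ω - μ) P := hTi.sub (integrable_const _)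
  have hU0 : ∫ ω, (T ω - μ) ∂P = 0 := by
    rw [integral_sub hTi (integrable_const _)]
    simp [hμ]
  have hcond : ∫ ω, T ω ∂P[|Z] = q⁻¹ * ∫ ω in Z, T ω ∂P := by
    rw [ProbabilityTheory.cond, integral_smul_measure, ENNReal.toReal_inv]
    rfl
  set d := (∫ ω, T ω ∂P[|Z]) - μ with hd
  have hdZ : ∫ ω in Z, (T ω - μ) ∂P = q * d := by
    rw [integral_sub hTi.integrableOn (integrable_const _), hd, hcond]
    simp only [integral_const, measureReal_restrict_apply_univ, smul_eq_mul]
    rw [← hq]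
    field_simp
  have hsqi : Integrable (fun ω => (T ω - μ) ^ 2) P := hU.integrable_sq
  have hVar : ∫ ω, (T ω - μ) ^ 2 ∂P = Var[T; P] :=
    (variance_eq_integral hT.aestronglyMeasurable.aemeasurable).symm
  -- Cauchy–Schwarz through a discriminant: the quadratic is the `P`-mean of the square of (T - μ) -
  -- l (1_Z / q - 1), and 1_Z / q - 1 has second moment 1/q - 1.
  have hquad : ∀ l : ℝ, 0 ≤ (q⁻¹ - 1) * (l * l) + (-(2 * d)) * l + Var[T; P] := by
    intro l
    have hnn : 0 ≤ ∫ ω, ((T ω - μ) - l * (Z.indicator (fun _ => q⁻¹) ω - 1)) ^ 2 ∂P :=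
      integral_nonneg fun _ => sq_nonneg _
    have hexp : ∀ ω, ((T ω - μ) - l * (Z.indicator (fun _ => q⁻¹) ω - 1)) ^ 2 =
        ((T ω - μ) ^ 2 + 2 * l * (T ω - μ) + l ^ 2) +
          Z.indicator (fun ω => -(2 * l * q⁻¹) * (T ω - μ) + l ^ 2 * (q⁻¹ ^ 2 - 2 * q⁻¹)) ω := by
      intro ω
      by_cases hω : ω ∈ Z
      · simp only [Set.indicator_of_mem hω]; ring
      · simp only [Set.indicator_of_notMem hω]; ring
    have hA : Integrable (fun ω => (T ω - μ) ^ 2 + 2 * l * (T ω - μ)) P :=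
      hsqi.add (hUi.const_mul _)
    have hB : Integrable
        (fun ω => -(2 * l * q⁻¹) * (T ω - μ) + l ^ 2 * (q⁻¹ ^ 2 - 2 * q⁻¹)) P :=
      (hUi.const_mul _).add (integrable_const _)
    have hA' : Integrable (fun ω => (T ω - μ) ^ 2 + 2 * l * (T ω - μ) + l ^ 2) P :=
      hA.add (integrable_const _)
    simp_rw [hexp] at hnn
    rw [integral_add hA' (hB.indicator hZ),
      integral_add hA (integrable_const _), integral_add hsqi (hUi.const_mul _),
      integral_const_mul, hU0, hVar, integral_indicator hZ,
      integral_add (hUi.const_mul _).integrableOn (integrable_const _), integral_const_mul,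
      hdZ] at hnn
    simp only [integral_const, measureReal_restrict_apply_univ, smul_eq_mul, probReal_univ]
      at hnn
    rw [← hq] at hnn
    convert hnn using 1
    field_simp
    ring
  have := discrim_le_zero hquad
  rw [discrim] at this
  linarith

theorem memLp_two_of_mse_lt_top {S : Type*} [MeasurableSpace S] {P : Measure S}
    [IsFiniteMeasure P] {T : S → ℝ} (hT : Measurable T) {a : ℝ} (h : mse P T a < ∞) :
    MemLp T 2 P := by
  have h1 : MemLp (fun N => T N - a) 2 P := by
    rw [memLp_two_iff_integrable_sq (by fun_prop)]
    refine ⟨by fun_prop, ?_⟩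
    rw [hasFiniteIntegral_iff_ofReal (ae_of_all _ fun _ => sq_nonneg _)]
    exact h
  simpa [Pi.add_def] using h1.add (memLp_const (μ := P) (p := 2) a)

/-- The bias-variance decomposition of the mean squared error. -/
theorem variance_add_bias_sq_le {S : Type*} [MeasurableSpace S] {P : Measure S}
    [IsProbabilityMeasure P] {T : S → ℝ} (hT : Measurable T) {a b : ℝ} (hb : 0 ≤ b)
    (h : mse P T a ≤ ENNReal.ofReal b) : Var[T; P] + bias P T a ^ 2 ≤ b := by
  have hL := memLp_two_of_mse_lt_top hT (h.trans_lt ENNReal.ofReal_lt_top)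
  have hL' : MemLp (fun N => T N - a) 2 P := hL.sub (memLp_const a)
  have h1 := variance_eq_sub hL'
  rw [variance_sub_const hL.aestronglyMeasurable,
    integral_sub (hL.integrable (by norm_num)) (integrable_const _)] at h1
  have h2 : ∫ N, (T N - a) ^ 2 ∂P ≤ b := by
    rw [integral_eq_lintegral_of_nonneg_ae (ae_of_all _ fun _ => sq_nonneg _) (by fun_prop)]
    exact ENNReal.toReal_le_of_le_ofReal hb h
  simp only [integral_const, probReal_univ, one_smul] at h1
  have h3 : ∫ N, ((fun N => T N - a) ^ 2) N ∂P = ∫ N, (T N - a) ^ 2 ∂P := rfl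
  rw [h3] at h1
  rw [bias]
  linarith

/-! ### Hölder norms and peaks. -/

theorem holderNorm_add_le {D : Type*} [MetricSpace D] (β : ℝ) (f g : D → ℝ) :
    holderNorm β (f + g) ≤ holderNorm β f + holderNorm β g := by
  unfold holderNorm
  rw [add_add_add_comm]
  refine add_le_add (iSup_le fun x => ?_) (iSup_le fun x => iSup_le fun y => iSup_le fun h => ?_)
  · refine le_trans ?_ (add_le_add (le_iSup (fun x => ENNReal.ofReal |f x|) x)
      (le_iSup (fun x => ENNReal.ofReal |g x|) x))
    rw [← ENNReal.ofReal_add (abs_nonneg _) (abs_nonneg _)]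
    exact ENNReal.ofReal_le_ofReal (abs_add_le _ _)
  · refine le_trans ?_ (add_le_add
      (le_iSup_of_le x (le_iSup_of_le y (le_iSup_of_le h le_rfl)))
      (le_iSup_of_le x (le_iSup_of_le y (le_iSup_of_le h le_rfl))))
    rw [← ENNReal.ofReal_add (by positivity) (by positivity), ← add_div]
    refine ENNReal.ofReal_le_ofReal (div_le_div_of_nonneg_right ?_ (by positivity))
    have : (f + g) x - (f + g) y = (f x - f y) + (g x - g y) := by simp; ring
    rw [this]
    exact abs_add_le _ _

theorem continuous_of_holderNorm_ne_top {D : Type*} [MetricSpace D] {β : ℝ} (hβ : 0 < β)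
    {f : D → ℝ} (hf : holderNorm β f ≠ ∞) : Continuous f := by
  have hH : HolderWith (holderNorm β f).toNNReal (NNReal.mk β hβ.le) f := by
    intro x y
    rcases eq_or_ne x y with rfl | h
    · simp
    have hd : 0 < dist x y ^ β := Real.rpow_pos_of_pos (dist_pos.2 h) _
    have h1 : ENNReal.ofReal (|f x - f y| / dist x y ^ β) ≤ holderNorm β f :=
      le_trans (le_iSup_of_le x (le_iSup_of_le y
        (le_iSup (fun _ : x ≠ y => ENNReal.ofReal (|f x - f y| / dist x y ^ β)) h))) le_add_self
    rw [ENNReal.coe_toNNReal hf, edist_dist, edist_dist, Real.dist_eq, NNReal.coe_mk,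
      ENNReal.ofReal_rpow_of_nonneg dist_nonneg hβ.le]
    calc ENNReal.ofReal |f x - f y|
        = ENNReal.ofReal (|f x - f y| / dist x y ^ β) * ENNReal.ofReal (dist x y ^ β) := by
          rw [← ENNReal.ofReal_mul (by positivity), div_mul_cancel₀ _ hd.ne']
      _ ≤ _ := by gcongr
  exact hH.continuous (by exact_mod_cast hβ)

/-- A Hölder peak of height `a` and steepness `L` at `x₀`. -/
noncomputable def holderPeak {D : Type*} [MetricSpace D] (β a L : ℝ) (x₀ x : D) : ℝ :=
  max 0 (a - L * dist x x₀ ^ β)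

theorem measurable_holderPeak (β a L : ℝ) (x₀ : I) : Measurable (holderPeak β a L x₀) := by
  unfold holderPeak
  fun_prop

theorem holderPeak_nonneg {D : Type*} [MetricSpace D] (β a L : ℝ) (x₀ x : D) :
    0 ≤ holderPeak β a L x₀ x := le_max_left _ _

theorem holderPeak_le {D : Type*} [MetricSpace D] {β a L : ℝ} (ha : 0 ≤ a) (hL : 0 ≤ L)
    (x₀ x : D) : holderPeak β a L x₀ x ≤ a := by
  have : 0 ≤ L * dist x x₀ ^ β := by positivity
  exact max_le ha (by linarith)

theorem holderPeak_self {D : Type*} [MetricSpace D] {β a L : ℝ} (hβ : 0 < β) (ha : 0 ≤ a)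
    (x₀ : D) : holderPeak β a L x₀ x₀ = a := by
  simp [holderPeak, Real.zero_rpow hβ.ne', ha]

theorem holderPeak_eq_zero {D : Type*} [MetricSpace D] {β a L : ℝ} (hβ : 0 < β) (ha : 0 ≤ a)
    (hL : 0 < L) {x₀ x : D} (h : (a / L) ^ β⁻¹ ≤ dist x x₀) : holderPeak β a L x₀ x = 0 := by
  refine max_eq_left ?_
  have h1 : ((a / L) ^ β⁻¹) ^ β ≤ dist x x₀ ^ β :=
    Real.rpow_le_rpow (by positivity) h hβ.le
  rw [Real.rpow_inv_rpow (by positivity) hβ.ne', div_le_iff₀ hL] at h1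
  linarith

/-- Subadditivity of t ↦ t^β for β ≤ 1. It gives a peak of steepness L a Hölder constant of at most
L. -/
theorem abs_rpow_sub_rpow_le {β u v d : ℝ} (hβ0 : 0 ≤ β) (hβ1 : β ≤ 1) (hu : 0 ≤ u)
    (hv : 0 ≤ v) (h : |u - v| ≤ d) : |u ^ β - v ^ β| ≤ d ^ β := by
  have key : ∀ {u v : ℝ}, 0 ≤ u → 0 ≤ v → u - v ≤ d → 0 ≤ d → u ^ β - v ^ β ≤ d ^ β := by
    intro u v hu hv h hd
    have h1 : u ^ β ≤ (v + d) ^ β := Real.rpow_le_rpow hu (by linarith) hβ0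
    have h2 := Real.rpow_add_le_add_rpow hv hd hβ0 hβ1
    linarith
  have hd := (abs_nonneg _).trans h
  rw [abs_le] at h
  rw [abs_le]
  constructor
  · have := key hv hu (by linarith) hd
    linarith
  · exact key hu hv (by linarith) hd

theorem holderNorm_holderPeak_le {D : Type*} [MetricSpace D] {β a L : ℝ} (hβ0 : 0 < β)
    (hβ1 : β ≤ 1) (ha : 0 ≤ a) (hL : 0 ≤ L) (x₀ : D) :
    holderNorm β (holderPeak β a L x₀) ≤ ENNReal.ofReal (a + L) := by
  rw [ENNReal.ofReal_add ha hL]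
  refine add_le_add (iSup_le fun x => ENNReal.ofReal_le_ofReal ?_)
    (iSup_le fun x => iSup_le fun y => iSup_le fun h => ENNReal.ofReal_le_ofReal ?_)
  · rw [abs_of_nonneg (holderPeak_nonneg _ _ _ _ _)]
    exact holderPeak_le ha hL _ _
  · rw [div_le_iff₀ (Real.rpow_pos_of_pos (dist_pos.2 h) _)]
    have h1 : |dist x x₀ ^ β - dist y x₀ ^ β| ≤ dist x y ^ β :=
      abs_rpow_sub_rpow_le hβ0.le hβ1 dist_nonneg dist_nonneg (abs_dist_sub_le _ _ _)
    calc |holderPeak β a L x₀ x - holderPeak β a L x₀ y|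
        ≤ |(a - L * dist x x₀ ^ β) - (a - L * dist y x₀ ^ β)| := by
          rw [holderPeak, holderPeak, max_comm 0, max_comm 0]
          exact abs_max_sub_max_le_abs _ _ _
      _ = L * |dist x x₀ ^ β - dist y x₀ ^ β| := by
          rw [← abs_of_nonneg hL, ← abs_mul, abs_of_nonneg hL, ← abs_neg]
          congr 1; ring
      _ ≤ L * dist x y ^ β := by gcongr

/-- The condition K(0) = 1 alone forces a norm of at least 1. Nothing else about κ is needed. -/
theorem two_le_kappa (β : ℝ) : 2 ≤ kappa β := by
  have h : (1 : ℝ≥0∞) ≤ ⨅ (K : ℝ → ℝ) (_ : MemLp K 2 volume ∧ K 0 = 1 ∧ ∀ x, 0 ≤ K x),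
      holderNorm β K := by
    refine le_iInf₂ fun K hK => ?_
    refine le_trans ?_ (le_self_add : _ ≤ holderNorm β K)
    refine le_trans ?_ (le_iSup (fun x => ENNReal.ofReal |K x|) 0)
    simp [hK.2.1]
  calc (2 : ℝ≥0∞) = 2 * 1 := (mul_one _).symm
    _ ≤ _ := mul_le_mul_right h 2

/-! ### Intensity of the region between two boundaries. -/

theorem boundaryIntensity_eq {n : ℝ} {f : I → ℝ} (hf : Measurable f) :
    boundaryIntensity n f =
      ENNReal.ofReal n • (volume : Measure (I × ℝ)).restrict {p : I × ℝ | f p.1 ≤ p.2} := by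
  have hm : MeasurableSet {p : I × ℝ | f p.1 ≤ p.2} :=
    measurableSet_le (hf.comp measurable_fst) measurable_snd
  rw [boundaryIntensity, withDensity_indicator hm, withDensity_const]

theorem sigmaFinite_boundaryIntensity {n : ℝ} {f : I → ℝ} :
    SigmaFinite (boundaryIntensity n f) := by
  refine SigmaFinite.withDensity_of_ne_top (ae_of_all _ fun p => ?_)
  by_cases hp : p ∈ {p : I × ℝ | f p.1 ≤ p.2} <;> simp [Set.indicator, hp]

theorem boundaryIntensity_restrict {n : ℝ} {f g : I → ℝ} (hf : Measurable f)
    (hg : Measurable g) (hfg : ∀ x, f x ≤ g x) :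
    (boundaryIntensity n f).restrict {p : I × ℝ | f p.1 ≤ p.2 ∧ p.2 < g p.1}ᶜ =
      boundaryIntensity n g := by
  have hA : MeasurableSet {p : I × ℝ | f p.1 ≤ p.2 ∧ p.2 < g p.1} :=
    (measurableSet_le (hf.comp measurable_fst) measurable_snd).inter
      (measurableSet_lt measurable_snd (hg.comp measurable_fst))
  rw [boundaryIntensity_eq hf, boundaryIntensity_eq hg, Measure.restrict_smul,
    Measure.restrict_restrict hA.compl]
  congr 2
  ext p
  simp only [Set.mem_inter_iff, Set.mem_compl_iff, Set.mem_ofPred_eq, not_and, not_lt]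
  exact ⟨fun h => h.1 h.2, fun h => ⟨fun _ => h, (hfg _).trans h⟩⟩

theorem volume_unitInterval_le (x₀ : I) (r : ℝ) :
    (volume : Measure I) (Metric.ball x₀ r) ≤ ENNReal.ofReal (2 * r) := by
  have h : ((↑) : I → ℝ) '' Metric.ball x₀ r ⊆ Metric.ball (x₀ : ℝ) r := by
    rintro _ ⟨x, hx, rfl⟩
    exact hx
  calc (volume : Measure I) (Metric.ball x₀ r)
      = volume (((↑) : I → ℝ) '' Metric.ball x₀ r) :=
        comap_subtype_coe_apply measurableSet_Icc _ _
    _ ≤ volume (Metric.ball (x₀ : ℝ) r) := measure_mono h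
    _ = _ := Real.volume_ball _ _

theorem boundaryIntensity_peak_le {β a L n : ℝ} (hβ : 0 < β) (ha : 0 ≤ a) (hL : 0 < L)
    (hn : 0 ≤ n) {f : I → ℝ} (hf : Measurable f) (x₀ : I) :
    boundaryIntensity n f {p | f p.1 ≤ p.2 ∧ p.2 < (f + holderPeak β a L x₀) p.1} ≤
      ENNReal.ofReal (n * (2 * a * (a / L) ^ β⁻¹)) := by
  have hpm := measurable_holderPeak β a L x₀
  have hA : MeasurableSet {p : I × ℝ | f p.1 ≤ p.2 ∧ p.2 < (f + holderPeak β a L x₀) p.1} :=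
    (measurableSet_le (hf.comp measurable_fst) measurable_snd).inter
      (measurableSet_lt measurable_snd ((hf.add hpm).comp measurable_fst))
  rw [boundaryIntensity_eq hf, Measure.smul_apply, smul_eq_mul, ENNReal.ofReal_mul hn]
  gcongr
  refine (Measure.restrict_apply_le _ _).trans ?_
  rw [Measure.volume_eq_prod, Measure.prod_apply hA]
  set r := (a / L) ^ β⁻¹
  calc ∫⁻ x, volume (Prod.mk x ⁻¹'
          {p : I × ℝ | f p.1 ≤ p.2 ∧ p.2 < (f + holderPeak β a L x₀) p.1})
      ≤ ∫⁻ x, (Metric.ball x₀ r).indicator (fun _ => ENNReal.ofReal a) x := by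
        refine lintegral_mono fun x => ?_
        have hx : Prod.mk x ⁻¹' {p : I × ℝ | f p.1 ≤ p.2 ∧ p.2 < (f + holderPeak β a L x₀) p.1}
            = Set.Ico (f x) (f x + holderPeak β a L x₀ x) := rfl
        rw [hx, Real.volume_Ico, add_sub_cancel_left]
        by_cases h : x ∈ Metric.ball x₀ r
        · rw [Set.indicator_of_mem h]
          exact ENNReal.ofReal_le_ofReal (holderPeak_le ha hL.le _ _)
        · rw [Metric.mem_ball, not_lt] at h
          rw [holderPeak_eq_zero hβ ha hL h]
          simp
    _ = ENNReal.ofReal a * volume (Metric.ball x₀ r) := by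
        rw [lintegral_indicator Metric.isOpen_ball.measurableSet, setLIntegral_const]
    _ ≤ ENNReal.ofReal a * ENNReal.ofReal (2 * r) := by
        gcongr
        exact volume_unitInterval_le _ _
    _ = ENNReal.ofReal (2 * a * r) := by
        rw [← ENNReal.ofReal_mul ha]; congr 1; ring

/-- The change of the mean of a statistic when a peak is added to the boundary. -/
theorem sq_sub_integral_le_of_peak {β a L n M : ℝ} (hβ : 0 < β) (ha : 0 ≤ a)
    (hL : 0 < L) (hn : 0 ≤ n) {f : I → ℝ} (hf : Measurable f) (x₀ : I)
    {P Q : Measure (Measure (I × ℝ))} (hP : IsPoissonPointProcess P (boundaryIntensity n f))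
    (hQ : IsPoissonPointProcess Q (boundaryIntensity n (f + holderPeak β a L x₀)))
    {T : Measure (I × ℝ) → ℝ} (hT : MemLp T 2 P) (hM : n * (2 * a * (a / L) ^ β⁻¹) ≤ M) :
    ((∫ N, T N ∂Q) - ∫ N, T N ∂P) ^ 2 ≤ (Real.exp M - 1) * Var[T; P] := by
  have := hP.isProbabilityMeasure
  have := sigmaFinite_boundaryIntensity (n := n) (f := f)
  have hpm := measurable_holderPeak β a L x₀
  set A := {p : I × ℝ | f p.1 ≤ p.2 ∧ p.2 < (f + holderPeak β a L x₀) p.1} with hAdef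
  have hA : MeasurableSet A :=
    (measurableSet_le (hf.comp measurable_fst) measurable_snd).inter
      (measurableSet_lt measurable_snd ((hf.add hpm).comp measurable_fst))
  have hΛ := boundaryIntensity_peak_le hβ ha hL hn hf x₀
  have hfin : boundaryIntensity n f A ≠ ∞ := (hΛ.trans_lt ENNReal.ofReal_lt_top).ne
  rw [← boundaryIntensity_restrict hf (hf.add hpm)
    (fun x => le_add_of_nonneg_right (holderPeak_nonneg _ _ _ _ _))] at hQ
  have hZ := hP.measure_eq_zero hA hfin
  rw [← hP.cond_eq hA hfin hQ]
  have hZm : MeasurableSet {N : Measure (I × ℝ) | N A = 0} :=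
    Measure.measurable_coe hA (measurableSet_singleton _)
  refine (sq_integral_cond_sub_le hZm (by rw [hZ]; simp [Real.exp_pos]) hT).trans ?_
  refine mul_le_mul_of_nonneg_right ?_ (variance_nonneg _ _)
  rw [measureReal_def, hZ, ENNReal.toReal_ofReal (Real.exp_pos _).le, Real.exp_neg, inv_inv]
  gcongr
  exact (ENNReal.toReal_le_of_le_ofReal (by positivity) hΛ).trans hM

/-! ### Choice of constants and the lower bounds. -/

/-- The exponent is tuned so that B = (C/n)^(β/(β+1)) satisfies B · B^(1/β) = C/n, which cancels n.
-/
theorem peak_intensity_le {β C L n s a : ℝ} (hβ : 0 < β) (hC : 0 < C) (hL : 0 < L) (hn : 0 < n)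
    (hs : 0 ≤ s) (ha : 0 ≤ a) (h : a ≤ s * (C / n) ^ (β / (β + 1))) :
    n * (2 * a * (a / L) ^ β⁻¹) ≤ 2 * s * (s / L) ^ β⁻¹ * C := by
  set B := (C / n) ^ (β / (β + 1)) with hB
  have hB0 : 0 < B := Real.rpow_pos_of_pos (by positivity) _
  have hBB : B * B ^ β⁻¹ = C / n := by
    rw [hB, ← Real.rpow_mul (by positivity), ← Real.rpow_add (by positivity)]
    have : β / (β + 1) + β / (β + 1) * β⁻¹ = 1 := by
      have : β + 1 ≠ 0 := by positivity
      field_simp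
    rw [this, Real.rpow_one]
  calc n * (2 * a * (a / L) ^ β⁻¹)
      ≤ n * (2 * (s * B) * (s * B / L) ^ β⁻¹) := by gcongr
    _ = 2 * s * (s / L) ^ β⁻¹ * (n * (B * B ^ β⁻¹)) := by
        rw [mul_div_right_comm s B L, Real.mul_rpow (by positivity) hB0.le]
        ring
    _ = 2 * s * (s / L) ^ β⁻¹ * C := by
        rw [hBB, mul_div_cancel₀ _ hn.ne']

/-- The exponent is a multiple of s^(1+1/β), which is o(s²) precisely because β < 1. Once it is at
most s²/8, the bound |exp x - 1| ≤ 2|x| finishes. -/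
theorem exists_small_height {β C L A : ℝ} (hβ0 : 0 < β) (hβ1 : β < 1) (hC : 0 < C) (hL : 0 < L)
    (hA : 0 < A) :
    ∃ s : ℝ, 0 < s ∧ s ≤ A ∧ Real.exp (2 * s * (s / L) ^ β⁻¹ * C) - 1 ≤ (s / 2) ^ 2 := by
  have hδ : 0 < β⁻¹ - 1 := by
    have := (one_lt_inv₀ hβ0).2 hβ1
    linarith
  set k := 2 * C / L ^ β⁻¹ with hk
  have hk0 : 0 < k := by positivity
  have hlim : Filter.Tendsto (fun s : ℝ => s ^ (β⁻¹ - 1)) (nhds 0) (nhds 0) := by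
    have := (Real.continuousAt_rpow_const 0 (β⁻¹ - 1) (Or.inr hδ.le)).tendsto
    rwa [Real.zero_rpow hδ.ne'] at this
  have hev : ∀ᶠ s : ℝ in nhdsWithin 0 (Set.Ioi 0),
      s ^ (β⁻¹ - 1) < 1 / (8 * k) ∧ s < min A 1 ∧ 0 < s := by
    refine ((hlim.eventually_lt_const (by positivity)).filter_mono nhdsWithin_le_nhds).and
      (((eventually_lt_nhds (by positivity)).filter_mono nhdsWithin_le_nhds).and
        self_mem_nhdsWithin)
  obtain ⟨s, hs1, hs2, hs0⟩ := hev.exists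
  refine ⟨s, hs0, (hs2.trans_le (min_le_left _ _)).le, ?_⟩
  have hs1' : s < 1 := hs2.trans_le (min_le_right _ _)
  have hM : 2 * s * (s / L) ^ β⁻¹ * C = k * s ^ 2 * s ^ (β⁻¹ - 1) := by
    rw [Real.rpow_sub_one hs0.ne', Real.div_rpow hs0.le hL.le, hk]
    field_simp
  have hM' : 2 * s * (s / L) ^ β⁻¹ * C ≤ s ^ 2 / 8 := by
    rw [hM]
    calc k * s ^ 2 * s ^ (β⁻¹ - 1) ≤ k * s ^ 2 * (1 / (8 * k)) := by gcongr
      _ = s ^ 2 / 8 := by field_simp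
  have hM0 : 0 ≤ 2 * s * (s / L) ^ β⁻¹ * C := by positivity
  have hs2' : s ^ 2 ≤ 1 := by nlinarith
  have := Real.abs_exp_sub_one_le (x := 2 * s * (s / L) ^ β⁻¹ * C)
    (by rw [abs_of_nonneg hM0]; linarith)
  rw [abs_of_nonneg hM0] at this
  have := (abs_le.1 this).2
  nlinarith

theorem theorem4p1 (β C R : ℝ) (hβ0 : 0 < β) (hβ1 : β < 1) (hC : 0 < C)
    (hR : kappa β < ENNReal.ofReal R) :
    ∃ c : ℝ, 0 < c ∧ ∃ c' : ℝ, 0 < c' ∧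
      ∀ (n : ℝ), 1 ≤ n → ∀ (x₀ : I)
        (P : (I → ℝ) → Measure (Measure (I × ℝ))),
        (∀ f ∈ holderBall β (ENNReal.ofReal R),
          IsPoissonPointProcess (P f) (boundaryIntensity n f)) →
        ∀ T : Measure (I × ℝ) → ℝ, Measurable T →
          (⨆ f ∈ holderBall β (ENNReal.ofReal R), mse (P f) T (f x₀)) <
            ENNReal.ofReal ((C / n) ^ (2 * β / (β + 1))) →
          ENNReal.ofReal (c * n ^ (-(2 * β / (β + 1)))) ≤
              (⨆ f ∈ holderBall β (ENNReal.ofReal R),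
                ENNReal.ofReal (bias (P f) T (f x₀) ^ 2)) ∧
            ((⨆ f ∈ holderBall β (ENNReal.ofReal R),
                ENNReal.ofReal (bias (P f) T (f x₀) ^ 2)) ≤ 1 →
              ∀ f ∈ holderBall β ((ENNReal.ofReal R - kappa β) / 2),
                ENNReal.ofReal (c' * n ^ (-(2 * β / (β + 1)))) ≤ evariance T (P f)) := by
  have hR2 : 2 < R := by
    have := (two_le_kappa β).trans_lt hR
    rwa [← ENNReal.ofReal_ofNat 2, ENNReal.ofReal_lt_ofReal_iff_of_nonneg (by norm_num)] at this
  set θ := β / (β + 1) with hθ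
  have hθ0 : 0 < θ := by positivity
  have h2θ : 2 * β / (β + 1) = θ * (2 : ℕ) := by rw [hθ]; push_cast; ring
  -- With height at most 2 + L the peak has norm at most 2 + 2L = 2 + (R - 2)/2, so adding it to f
  -- of norm at most (R - 2)/2 stays within R.
  set L := (R - 2) / 4 with hL
  have hL0 : 0 < L := by rw [hL]; linarith
  have hCθ : 0 < C ^ θ := Real.rpow_pos_of_pos hC _
  -- The cap on s makes the height s * B at most 2 + L for every n ≥ 1, since w ≤ 1.
  obtain ⟨s, hs0, hsA, hsM⟩ := exists_small_height hβ0 hβ1 hC hL0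
    (div_pos (by positivity : 0 < 2 + L) hCθ)
  set M := 2 * 3 * (3 / L) ^ β⁻¹ * C with hM
  have hM0 : 0 < Real.exp M - 1 := by
    have : 0 < M := by positivity
    have := Real.add_one_lt_exp this.ne'
    linarith
  have hm0 : 0 < min (C ^ θ) L := lt_min hCθ hL0
  refine ⟨(s / 4 * C ^ θ) ^ 2, by positivity, (min (C ^ θ) L) ^ 2 / (Real.exp M - 1),
    by positivity, ?_⟩
  intro n hn x₀ P hP T hT hmse
  have hn0 : 0 < n := by linarith
  set w := n ^ (-θ) with hw
  have hw0 : 0 < w := Real.rpow_pos_of_pos hn0 _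
  have hw1 : w ≤ 1 := Real.rpow_le_one_of_one_le_of_nonpos hn (by linarith)
  have hw2 : n ^ (-(2 * β / (β + 1))) = w ^ 2 := by
    rw [h2θ, ← neg_mul, Real.rpow_mul hn0.le, Real.rpow_natCast]
  have hB : (C / n) ^ θ = C ^ θ * w := by
    rw [Real.div_rpow hC.le hn0.le, hw, Real.rpow_neg hn0.le, div_eq_mul_inv]
  set B := C ^ θ * w with hBdef
  have hB0 : 0 < B := by positivity
  have hB2 : (C / n) ^ (2 * β / (β + 1)) = B ^ 2 := by
    rw [h2θ, Real.rpow_mul (by positivity), Real.rpow_natCast, hB]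
  rw [hB2] at hmse
  rw [hw2]
  have hmse' : ∀ f ∈ holderBall β (ENNReal.ofReal R),
      mse (P f) T (f x₀) ≤ ENNReal.ofReal (B ^ 2) := fun f hf =>
    (le_iSup₂ (f := fun f (_ : f ∈ holderBall β (ENNReal.ofReal R)) => mse (P f) T (f x₀))
      f hf).trans hmse.le
  have hL2 : ∀ f ∈ holderBall β (ENNReal.ofReal R), MemLp T 2 (P f) := fun f hf => by
    have := (hP f hf).isProbabilityMeasure
    exact memLp_two_of_mse_lt_top hT ((hmse' f hf).trans_lt ENNReal.ofReal_lt_top)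
  have hbv : ∀ f ∈ holderBall β (ENNReal.ofReal R),
      Var[T; P f] + bias (P f) T (f x₀) ^ 2 ≤ B ^ 2 := fun f hf => by
    have := (hP f hf).isProbabilityMeasure
    exact variance_add_bias_sq_le hT (by positivity) (hmse' f hf)
  have hball : ∀ f : I → ℝ, holderNorm β f ≤ ENNReal.ofReal ((R - 2) / 2) → ∀ a : ℝ, 0 ≤ a →
      a ≤ 2 + L → f ∈ holderBall β (ENNReal.ofReal R) ∧
        f + holderPeak β a L x₀ ∈ holderBall β (ENNReal.ofReal R) := by
    intro f hf a ha haL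
    refine ⟨hf.trans (ENNReal.ofReal_le_ofReal (by linarith)), ?_⟩
    refine (holderNorm_add_le β f _).trans ((add_le_add hf
      (holderNorm_holderPeak_le hβ0 hβ1.le ha hL0.le x₀)).trans ?_)
    rw [← ENNReal.ofReal_add (by linarith) (by linarith)]
    exact ENNReal.ofReal_le_ofReal (by rw [hL] at haL ⊢; linarith)
  have hdiff : ∀ f : I → ℝ, holderNorm β f ≤ ENNReal.ofReal ((R - 2) / 2) → ∀ a t : ℝ, 0 ≤ a →
      a ≤ 2 + L → 0 ≤ t → a ≤ t * B →
      (bias (P (f + holderPeak β a L x₀)) T ((f + holderPeak β a L x₀) x₀) -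
        bias (P f) T (f x₀) + a) ^ 2 ≤
          (Real.exp (2 * t * (t / L) ^ β⁻¹ * C) - 1) * Var[T; P f] := by
    intro f hf a t ha haL ht hat
    obtain ⟨h1, h2⟩ := hball f hf a ha haL
    have hfm : Measurable f :=
      (continuous_of_holderNorm_ne_top hβ0 (hf.trans_lt ENNReal.ofReal_lt_top).ne).measurable
    have := sq_sub_integral_le_of_peak hβ0 ha hL0 hn0.le hfm x₀ (hP f h1) (hP _ h2) (hL2 f h1)
      (peak_intensity_le hβ0 hC hL0 hn0 ht ha (by rw [← hθ, hB]; exact hat))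
    convert this using 2
    simp only [bias, Pi.add_apply, holderPeak_self hβ0 ha]
    ring
  refine ⟨?_, fun hbias f hf => ?_⟩
  · have h0 : holderNorm β (0 : I → ℝ) ≤ ENNReal.ofReal ((R - 2) / 2) := by
      simp [holderNorm]
    have haL : s * B ≤ 2 + L := by
      have : s * C ^ θ ≤ 2 + L := (le_div_iff₀ hCθ).1 hsA
      nlinarith [mul_pos hs0 hCθ]
    have ha0 : 0 ≤ s * B := by positivity
    obtain ⟨h1, h2⟩ := hball 0 h0 _ ha0 haL
    have hd := hdiff 0 h0 _ s ha0 haL hs0.le le_rfl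
    have hV := hbv 0 h1
    set b₀ := bias (P 0) T ((0 : I → ℝ) x₀)
    set b₁ := bias (P (0 + holderPeak β (s * B) L x₀)) T
      ((0 + holderPeak β (s * B) L x₀ : I → ℝ) x₀)
    -- It follows that b₀ - b₁ ≥ s B / 2, so b₀ ≥ s B / 4 or b₁ ≤ -s B / 4.
    have hd' : (b₁ - b₀ + s * B) ^ 2 ≤ (s * B / 2) ^ 2 := by
      calc _ ≤ _ := hd
        _ ≤ (s / 2) ^ 2 * B ^ 2 := by
          refine mul_le_mul hsM ?_ (variance_nonneg _ _) (by positivity)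
          nlinarith [sq_nonneg b₀]
        _ = _ := by ring
    have hd'' := (abs_le_of_sq_le_sq' hd' (by positivity)).2
    have hc : (s / 4 * C ^ θ) ^ 2 * w ^ 2 = (s * B / 4) ^ 2 := by rw [hBdef]; ring
    rw [hc]
    have hle : ∀ f ∈ holderBall β (ENNReal.ofReal R),
        ENNReal.ofReal (bias (P f) T (f x₀) ^ 2) ≤
          ⨆ f ∈ holderBall β (ENNReal.ofReal R),
            ENNReal.ofReal (bias (P f) T (f x₀) ^ 2) := fun f hf =>
      le_iSup₂ (f := fun f (_ : f ∈ holderBall β (ENNReal.ofReal R)) =>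
        ENNReal.ofReal (bias (P f) T (f x₀) ^ 2)) f hf
    rcases le_total (s * B / 4) b₀ with h | h
    · refine le_trans (ENNReal.ofReal_le_ofReal ?_) (hle _ h1)
      exact pow_le_pow_left₀ (by positivity) h 2
    · refine le_trans (ENNReal.ofReal_le_ofReal ?_) (hle _ h2)
      change _ ≤ b₁ ^ 2
      nlinarith
  · have hf' : holderNorm β f ≤ ENNReal.ofReal ((R - 2) / 2) := by
      refine le_trans (α := ℝ≥0∞) hf ?_
      rw [ENNReal.ofReal_div_of_pos (by norm_num), ENNReal.ofReal_sub _ (by norm_num)]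
      simp only [ENNReal.ofReal_ofNat]
      gcongr
      exact two_le_kappa β
    -- If a = 3B, biases of size at most B leave b₁ - b₀ + a ≥ B. For small n the ball may only
    -- allow a = 2 + L; then biases of size at most 1 leave L, which is where the extra hypothesis
    -- enters.
    set a := min (2 + L) (3 * B) with ha
    have ha0 : 0 ≤ a := by positivity
    obtain ⟨h1, h2⟩ := hball f hf' a ha0 (min_le_left _ _)
    have hd := hdiff f hf' a 3 ha0 (min_le_left _ _) (by norm_num) (min_le_right _ _)
    have hb1 : ∀ f ∈ holderBall β (ENNReal.ofReal R), |bias (P f) T (f x₀)| ≤ 1 := by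
      intro f hf
      have := (le_iSup₂ (f := fun f (_ : f ∈ holderBall β (ENNReal.ofReal R)) =>
        ENNReal.ofReal (bias (P f) T (f x₀) ^ 2)) f hf).trans hbias
      exact (sq_le_one_iff_abs_le_one _).1 (ENNReal.ofReal_le_one.1 this)
    have hbB : ∀ f ∈ holderBall β (ENNReal.ofReal R), |bias (P f) T (f x₀)| ≤ B := by
      intro f hf
      refine abs_le_of_sq_le_sq ?_ hB0.le
      linarith [hbv f hf, variance_nonneg T (P f)]
    have p0 := abs_le.1 (hb1 _ h1)
    have p1 := abs_le.1 (hb1 _ h2)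
    have q0 := abs_le.1 (hbB _ h1)
    have q1 := abs_le.1 (hbB _ h2)
    set b₀ := bias (P f) T (f x₀)
    set b₁ := bias (P (f + holderPeak β a L x₀)) T ((f + holderPeak β a L x₀) x₀)
    have := (hP f h1).isProbabilityMeasure
    rw [← ofReal_variance (hL2 f h1)]
    refine ENNReal.ofReal_le_ofReal ?_
    have hmw : min (C ^ θ) L * w ≤ b₁ - b₀ + a := by
      rcases min_choice (2 + L) (3 * B) with h | h
      · have : min (C ^ θ) L * w ≤ L :=
          (mul_le_of_le_one_right hm0.le hw1).trans (min_le_right _ _)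
        rw [ha, h]
        linarith
      · have : min (C ^ θ) L * w ≤ B := mul_le_mul_of_nonneg_right (min_le_left _ _) hw0.le
        rw [ha, h]
        linarith
    rw [div_mul_eq_mul_div, div_le_iff₀ hM0, ← mul_pow, mul_comm (Var[T; P f])]
    exact (pow_le_pow_left₀ (by positivity) hmw 2).trans hd
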